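/- Let $K$ be an arbitrary field, let $n \geq p$ be integers, and let $r$ be an integer with $1 \leq r \leq p-1$. Let $M_{n,p}(K)$ be the vector space of $n \times p$ matrices with entries in $K$; $\operatorname{codim} V$ denotes the codimension of a linear subspace $V$ in $M_{n,p}(K)$. (a) If $V$ is a linear subspace of $M_{n,p}(K)$ with $\operatorname{codim} V < n$ and $\operatorname{codim} V \leq \binom{r+2}{2} - 2$, then $V$ is spanned by its rank $r$ matrices, i.e. $V$ is the linear span of $\{M \in V : \operatorname{rank} M = r\}$. (b) The bound is tight: for all such $K$, $n$, $p$, $r$ there is a linear subspace of $M_{n,p}(K)$ with codimension exactly $\binom{r+2}{2} - 1$ which is not spanned by its rank $r$ matrices. -/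

import Mathlib

/-! If the rank `r` members of `V` do not span `V`, some linear form `f` vanishes on all of them but
not at some `A₀` in `V`. Put `H = V ⊓ ker f`, of codimension at most `codim V + 1 < (r + 2).choose
2`; the form `f` is a nonzero constant on the affine space `A₀ + H`. Two facts contradict each other
there.

The minimal rank `t` on `A₀ + H` is at most `r`. At a member `A` of rank `t`, perturbations `X` of
the identity of `range A` that come from `H` must keep `1 - X` injective, so they form a space
without nonzero fixed vectors. Such a space has dimension at most `t.choose 2`
(`Submodule.FixedPointFree.finrank_le`), which forces `codim H ≥ (t + 1).choose 2`.

On the other hand, when `codim V < n`, a member of `V` of rank at most `r` is a combination of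
members of rank `r`, by raising the rank one unit at a time (`mem_span_finrank_range_succ`). This
rests on `exists_linearIndependent_add_of_codim_le`, which finds full-rank matrices in affine
spaces. Hence `f` vanishes at `A`, a contradiction. -/

/-! ### Spaces of endomorphisms without nonzero fixed vectors -/

theorem Submodule.finrank_map_add_finrank_inf_ker {K E F : Type*} [Field K]
    [AddCommGroup E] [Module K E] [FiniteDimensional K E] [AddCommGroup F] [Module K F]
    (f : E →ₗ[K] F) (H : Submodule K E) :
    Module.finrank K (H.map f) + Module.finrank K (H ⊓ LinearMap.ker f : Submodule K E) =
      Module.finrank K H := by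
  rw [← LinearMap.finrank_range_add_finrank_ker (f.domRestrict H), LinearMap.range_domRestrict,
    LinearMap.ker_domRestrict]
  rw [← Submodule.finrank_map_subtype_eq, Submodule.map_comap_subtype]

theorem Submodule.finrank_map_of_injective {K E F : Type*} [Field K]
    [AddCommGroup E] [Module K E] [FiniteDimensional K E] [AddCommGroup F] [Module K F]
    {f : E →ₗ[K] F} (hf : Function.Injective f) (H : Submodule K E) :
    Module.finrank K (H.map f) = Module.finrank K H := by
  rw [← Submodule.finrank_map_add_finrank_inf_ker f, LinearMap.ker_eq_bot.2 hf]
  simp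

/-- The restrictions to `ker φ` of the members of `V` with range in `ker φ`. -/
def Submodule.compression {K E : Type*} [Field K] [AddCommGroup E] [Module K E]
    (φ : Module.Dual K E) (V : Submodule K (Module.End K E)) :
    Submodule K (Module.End K (LinearMap.ker φ)) :=
  ((V ⊓ LinearMap.ker (LinearMap.compRight K φ)).map
    (LinearMap.lcomp K E (LinearMap.ker φ).subtype)).comap
      (LinearMap.compRight K (LinearMap.ker φ).subtype)

theorem Submodule.mem_compression {K E : Type*} [Field K] [AddCommGroup E] [Module K E]
    {φ : Module.Dual K E} {V : Submodule K (Module.End K E)}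
    {g : Module.End K (LinearMap.ker φ)} :
    g ∈ V.compression φ ↔
      ∃ f ∈ V, (∀ x, φ (f x) = 0) ∧ ∀ x : LinearMap.ker φ, f x = g x := by
  simp [Submodule.compression, LinearMap.ext_iff, and_assoc]

/-- No nonzero vector is fixed by a member of `V`. -/
def Submodule.FixedPointFree {K E : Type*} [Field K] [AddCommGroup E] [Module K E]
    (V : Submodule K (Module.End K E)) : Prop :=
  ∀ f ∈ V, ∀ x, f x = x → x = 0

theorem Submodule.FixedPointFree.compression {K E : Type*} [Field K] [AddCommGroup E] [Module K E]
    {V : Submodule K (Module.End K E)} (hV : V.FixedPointFree) (φ : Module.Dual K E) :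
    (V.compression φ).FixedPointFree := by
  intro g hg x hx
  obtain ⟨f, hf, -, hfg⟩ := Submodule.mem_compression.1 hg
  have := hV f hf x (by rw [hfg, hx])
  exact_mod_cast this

/-- The scalar `y x` is an eigenvalue of `y.smulRight x` with eigenvector `x`; if it were nonzero,
rescaling would make `x` a fixed vector. -/
theorem Submodule.FixedPointFree.apply_eq_zero {K E : Type*} [Field K] [AddCommGroup E] [Module K E]
    {V : Submodule K (Module.End K E)} (hV : V.FixedPointFree) {y : Module.Dual K E} {x : E}
    (h : y.smulRight x ∈ V) : y x = 0 := by
  by_contra hc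
  have h1 := hV _ (V.smul_mem (y x)⁻¹ h) x (by simp [smul_smul, hc])
  simp [h1] at hc

/-- Supplies the hyperplane `ker y` for the induction on dimension in the next theorem: a member of
`V` with range in `ker y` will be determined by its restriction to `ker y`. A form that works for
the compression to `ker φ` extends to `E` up to multiples of `φ`, and one of these extensions must
work. -/
theorem Submodule.FixedPointFree.exists_dual {K : Type*} [Field K] (n : ℕ) :
    ∀ {E : Type*} [AddCommGroup E] [Module K E] [FiniteDimensional K E]
    {V : Submodule K (Module.End K E)}, V.FixedPointFree → Module.finrank K E = n + 1 →
    ∃ y : Module.Dual K E, y ≠ 0 ∧ ∀ x, y.smulRight x ∈ V → x = 0 := by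
  induction n with
  | zero =>
    intro E _ _ _ V hV hE
    have : Nontrivial (Module.Dual K E) := by
      apply Module.nontrivial_of_finrank_pos (R := K)
      rw [Subspace.dual_finrank_eq, hE]; simp
    obtain ⟨y, hy⟩ := exists_ne (0 : Module.Dual K E)
    refine ⟨y, hy, fun x hx => ?_⟩
    have h1 := Module.Dual.finrank_ker_add_one_of_ne_zero hy
    have h2 : LinearMap.ker y = ⊥ := by
      rw [← Submodule.finrank_eq_zero (R := K)]; omega
    have h3 : x ∈ LinearMap.ker y := hV.apply_eq_zero hx
    simpa [h2] using h3
  | succ n ih =>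
    intro E _ _ _ V hV hE
    have : Nontrivial (Module.Dual K E) := by
      apply Module.nontrivial_of_finrank_pos (R := K)
      rw [Subspace.dual_finrank_eq, hE]; simp
    obtain ⟨φ, hφ⟩ := exists_ne (0 : Module.Dual K E)
    have h1 := Module.Dual.finrank_ker_add_one_of_ne_zero hφ
    obtain ⟨y', hy', hyV⟩ := ih (hV.compression φ) (by omega)
    obtain ⟨y, hy⟩ := LinearMap.exists_extend y'
    by_contra! hcon
    have key : ∀ c : K, ∃ u, φ u = 1 ∧ (y + c • φ).smulRight u ∈ V := by
      intro c
      have hne : y + c • φ ≠ 0 := by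
        rintro h0
        apply hy'
        rw [← hy]
        ext x
        have := LinearMap.congr_fun h0 x.1
        simpa using this
      obtain ⟨x, hx, hx0⟩ := hcon _ hne
      -- Otherwise `x` lies in `ker φ`, and the operator compresses to `y'.smulRight x`, which the
      -- choice of `y'` excludes.
      have hφx : φ x ≠ 0 := by
        intro h0
        have := hyV ⟨x, h0⟩ (Submodule.mem_compression.2 ⟨_, hx, by simp [h0], fun z => by
          simp [← hy]⟩)
        exact hx0 (congrArg Subtype.val this)
      refine ⟨(φ x)⁻¹ • x, by simp [hφx], ?_⟩
      convert V.smul_mem (φ x)⁻¹ hx using 1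
      ext z
      simp [smul_smul, mul_comm]
    -- The scalars 0 and 1 suffice, so the size of the field is irrelevant. From `y u = 0` and `y v
    -- = -1`, the difference of the two rank one operators fixes `u - v`; hence `u = v`, which is
    -- absurd.
    obtain ⟨u, hu, huV⟩ := key 0
    obtain ⟨v, hv, hvV⟩ := key 1
    have hyu := hV.apply_eq_zero huV
    have hyv := hV.apply_eq_zero hvV
    have hfix := hV _ (V.sub_mem huV hvV) (u - v) (by
      simp [hu, hv] at hyu hyv ⊢
      have : y v = -1 := by linear_combination hyv
      simp [hyu, this])
    have huv : u = v := sub_eq_zero.1 hfix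
    subst huv
    simp [hv] at hyu hyv
    simp [hyu] at hyv

/-- Rank-nullity for `f ↦ y ∘ f`, with `y` from `exists_dual`: in dimension `n + 1` the image misses
`y`, so it contributes at most `n`, and the kernel embeds in the compression to `ker y`, which
contributes at most `n.choose 2`. -/
theorem Submodule.FixedPointFree.finrank_le {K : Type*} [Field K] (n : ℕ) :
    ∀ {E : Type*} [AddCommGroup E] [Module K E] [FiniteDimensional K E]
    {V : Submodule K (Module.End K E)}, V.FixedPointFree → Module.finrank K E = n →
    Module.finrank K V ≤ n.choose 2 := by
  induction n with
  | zero =>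
    intro E _ _ _ V hV hE
    refine (Submodule.finrank_le V).trans ?_
    rw [Module.finrank_linearMap, hE]; simp
  | succ n ih =>
    intro E _ _ _ V hV hE
    obtain ⟨y, hy, hyV⟩ := hV.exists_dual n hE
    have hker := Module.Dual.finrank_ker_add_one_of_ne_zero hy
    have h1 := Submodule.finrank_map_add_finrank_inf_ker
      (LinearMap.compRight K (M := E) y) V
    have h2 : Module.finrank K (V.map (LinearMap.compRight K (M := E) y)) ≤ n := by
      -- If `y ∘ f = y`, then `y` vanishes on the range of `1 - f`, which is all of `E` since `f`
      -- has no nonzero fixed vector.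
      have hne : V.map (LinearMap.compRight K (M := E) y) ≠ ⊤ := by
        intro htop
        obtain ⟨f, hf, hfy⟩ : y ∈ V.map (LinearMap.compRight K (M := E) y) := by rw [htop]; trivial
        have hsurj : Function.Surjective ((1 : Module.End K E) - f) := by
          apply LinearMap.surjective_of_injective
          rw [← LinearMap.ker_eq_bot, LinearMap.ker_eq_bot']
          intro x hx
          exact hV f hf x (sub_eq_zero.1 hx).symm
        apply hy
        ext x
        obtain ⟨z, rfl⟩ := hsurj x
        have := LinearMap.congr_fun hfy z
        simp at this
        simp [this]
      have := Submodule.finrank_lt hne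
      have h3 : Module.finrank K (E →ₗ[K] K) = n + 1 := by
        rw [Module.finrank_linearMap, hE]; simp
      omega
    have h3 : Module.finrank K (V.compression y) ≤ n.choose 2 :=
      ih (hV.compression y) (by omega)
    have h4 := Submodule.finrank_map_add_finrank_inf_ker
      (LinearMap.lcomp K E (LinearMap.ker y).subtype)
      (V ⊓ LinearMap.ker (LinearMap.compRight K y))
    have h5 : (V ⊓ LinearMap.ker (LinearMap.compRight K y)) ⊓
        LinearMap.ker (LinearMap.lcomp K E (LinearMap.ker y).subtype) = ⊥ := by
      rw [eq_bot_iff]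
      rintro f ⟨⟨hf, -⟩, hf0⟩
      obtain ⟨e, he⟩ : ∃ e, y e = 1 := LinearMap.surjective (by exact hy) 1
      have hfe : f = y.smulRight (f e) := by
        ext z
        have hz : z - y z • e ∈ LinearMap.ker y := by simp [he]
        have := LinearMap.congr_fun (LinearMap.mem_ker.1 hf0) ⟨_, hz⟩
        simpa [sub_eq_zero] using this
      have h0 := hyV (f e) (hfe ▸ hf)
      rw [hfe, h0]
      simp
    have h6 : Module.finrank K (V.compression y) = Module.finrank K
        ((V ⊓ LinearMap.ker (LinearMap.compRight K y)).map
          (LinearMap.lcomp K E (LinearMap.ker y).subtype)) := by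
      have hle : (V ⊓ LinearMap.ker (LinearMap.compRight K y)).map
          (LinearMap.lcomp K E (LinearMap.ker y).subtype) ≤
          LinearMap.range (LinearMap.compRight K (M := LinearMap.ker y)
            (LinearMap.ker y).subtype) := by
        rintro _ ⟨f, ⟨-, hf⟩, rfl⟩
        refine ⟨(f ∘ₗ (LinearMap.ker y).subtype).codRestrict _ fun x => ?_, ?_⟩
        · exact LinearMap.congr_fun hf x.1
        · rfl
      have hinj : Function.Injective (LinearMap.compRight K (M := LinearMap.ker y)
            (LinearMap.ker y).subtype) := by
        intro f g hfg
        ext x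
        exact LinearMap.congr_fun hfg x
      rw [← Submodule.finrank_map_of_injective hinj]
      rw [Submodule.compression, Submodule.map_comap_eq_of_le hle]
    rw [h5, finrank_bot] at h4
    have : (n + 1).choose 2 = n + n.choose 2 := by
      rw [Nat.choose_succ_succ' n 1]; simp
    refine h1.symm.trans_le ?_
    omega

/-! ### Full-rank matrices, as independent families of columns, in affine spaces -/

theorem LinearIndependent.of_mkQ_span_singleton {K F ι : Type*} [Field K] [AddCommGroup F]
    [Module K F] [Fintype ι] {x : F} (hx : x ≠ 0) {v : ι → F}
    (h : LinearIndependent K ((K ∙ x).mkQ ∘ v)) :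
    LinearIndependent K v ∧ x ∉ Submodule.span K (Set.range v) := by
  refine ⟨h.of_comp, fun hmem => hx ?_⟩
  obtain ⟨c, hc⟩ := (Submodule.mem_span_range_iff_exists_fun K).1 hmem
  have h0 : ∑ i, c i • ((K ∙ x).mkQ ∘ v) i = 0 := by
    have := congrArg (K ∙ x).mkQ hc
    rw [map_sum, Submodule.mkQ_apply _ x,
      (Submodule.Quotient.mk_eq_zero _).2 (Submodule.mem_span_singleton_self x)] at this
    simpa using this
  have := Fintype.linearIndependent_iff.1 h c h0
  simp [← hc, this]

theorem exists_linearIndependent_notMem_span {K F : Type*} [Field K] [AddCommGroup F] [Module K F]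
    [FiniteDimensional K F] {x : F} (hx : x ≠ 0) {m : ℕ} (hm : m < Module.finrank K F) :
    ∃ v : Fin m → F, LinearIndependent K v ∧ x ∉ Submodule.span K (Set.range v) := by
  have h1 := Submodule.finrank_quotient_add_finrank (K ∙ x)
  rw [finrank_span_singleton hx] at h1
  obtain ⟨w, hw⟩ := exists_linearIndependent_of_le_finrank (R := K) (M := F ⧸ (K ∙ x)) (n := m)
    (by omega)
  choose v hv using fun i => (K ∙ x).mkQ_surjective (w i)
  have hvw : (K ∙ x).mkQ ∘ v = w := funext hv
  exact ⟨v, LinearIndependent.of_mkQ_span_singleton hx (hvw ▸ hw)⟩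

theorem LinearIndependent.castSucc_add_succ {K F : Type*} [Field K] [AddCommGroup F]
    [Module K F] {p : ℕ} {u : Fin (p + 1) → F} (hu : LinearIndependent K u) :
    LinearIndependent K fun i : Fin p => u i.castSucc + u i.succ := by
  rw [Fintype.linearIndependent_iff]
  intro c hc
  -- The coefficient of `u j` is `c j + c (j - 1)`, with 0 for indices out of range; the
  -- coefficients `c` then vanish one after another.
  have h0 : ∑ j, ((Fin.snoc c 0 : Fin (p + 1) → K) j + (Fin.cons 0 c : Fin (p + 1) → K) j) • u j
      = 0 := by
    simp_rw [add_smul, Finset.sum_add_distrib]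
    rw [Fin.sum_univ_castSucc, Fin.sum_univ_succ
      (fun j => (Fin.cons 0 c : Fin (p + 1) → K) j • u j)]
    simpa [Finset.sum_add_distrib] using hc
  have h1 := Fintype.linearIndependent_iff.1 hu _ h0
  cases p with
  | zero => exact fun i => i.elim0
  | succ p =>
    intro i
    induction i using Fin.induction with
    | zero => simpa using h1 (Fin.castSucc 0)
    | succ i ih =>
      have h2 := h1 (Fin.castSucc i.succ)
      rw [Fin.snoc_castSucc, ← Fin.succ_castSucc, Fin.cons_succ, ih] at h2
      simpa using h2

/-- The vectors occurring in column `0` of those families in `H` that vanish in all the others. -/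
def Submodule.headColumn {K F : Type*} [Field K] [AddCommGroup F] [Module K F] {p : ℕ}
    (H : Submodule K (Fin (p + 1) → F)) : Submodule K F :=
  H.comap (LinearMap.single K (fun _ => F) 0)

theorem Submodule.finrank_tail_add_finrank_headColumn {K F : Type*} [Field K] [AddCommGroup F]
    [Module K F] [FiniteDimensional K F] {p : ℕ} (H : Submodule K (Fin (p + 1) → F)) :
    Module.finrank K (H.map (LinearMap.funLeft K F Fin.succ)) + Module.finrank K H.headColumn =
      Module.finrank K H := by
  rw [← H.finrank_map_add_finrank_inf_ker (LinearMap.funLeft K F Fin.succ)]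
  congr 1
  rw [← Submodule.finrank_map_of_injective
    (LinearMap.ker_eq_bot.1 (LinearMap.ker_single K (fun _ : Fin (p + 1) => F) 0)) H.headColumn]
  congr 2 <;>
  · ext M
    constructor
    · rintro ⟨x, hx, rfl⟩
      exact ⟨hx, by ext i; simp [LinearMap.funLeft_apply]⟩
    · rintro ⟨hM, hM0⟩
      have : Pi.single 0 (M 0) = M := by
        ext i
        refine Fin.cases (by simp) (fun i => ?_) i
        have := congr_fun (LinearMap.mem_ker.1 hM0) i
        simpa [LinearMap.funLeft_apply] using this.symm
      exact ⟨M 0, by simpa [Submodule.headColumn, this] using hM, this⟩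

/-- Column `0` can be changed by `x` without touching the others, and at least one of its two values
lies outside the span of the others. -/
theorem exists_linearIndependent_add_of_tail {K F : Type*} [Field K] [AddCommGroup F]
    [Module K F] {p : ℕ} {H : Submodule K (Fin (p + 1) → F)}
    {A M : Fin (p + 1) → F} (hM : M ∈ H)
    (h : LinearIndependent K fun i : Fin p => (A + M) i.succ) {x : F} (hx : x ∈ H.headColumn)
    (hxM : x ∉ Submodule.span K (Set.range fun i : Fin p => (A + M) i.succ)) :
    ∃ M ∈ H, LinearIndependent K (A + M) := by
  by_cases h0 : (A + M) 0 ∈ Submodule.span K (Set.range fun i : Fin p => (A + M) i.succ)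
  · refine ⟨M + Pi.single 0 x, H.add_mem hM (show Pi.single 0 x ∈ H from hx), ?_⟩
    have : A + (M + Pi.single 0 x) = (Fin.cons ((A + M) 0 + x) fun i : Fin p => (A + M) i.succ :
        Fin (p + 1) → F) := by
      ext i
      refine Fin.cases ?_ (fun i => ?_) i <;> simp [add_assoc]
    rw [this, linearIndependent_finCons]
    exact ⟨h, fun h1 => hxM (by simpa using Submodule.sub_mem _ h1 h0)⟩
  · refine ⟨M, hM, ?_⟩
    rw [← Fin.cons_self_tail (A + M), linearIndependent_finCons]
    exact ⟨h, h0⟩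

/-- The kernel consists of families of multiples of `x`. As the ambient dimension also drops by `p`,
passing to the quotient does not increase the codimension. -/
theorem Submodule.finrank_le_finrank_map_mkQ_add {K F : Type*} [Field K] [AddCommGroup F]
    [Module K F] [FiniteDimensional K F] {p : ℕ} (H : Submodule K (Fin p → F)) (x : F) (hx : x ≠ 0) :
    Module.finrank K H ≤ Module.finrank K (H.map ((K ∙ x).mkQ.compLeft (Fin p))) + p := by
  rw [← H.finrank_map_add_finrank_inf_ker ((K ∙ x).mkQ.compLeft (Fin p))]
  gcongr
  have h1 := LinearMap.finrank_range_add_finrank_ker ((K ∙ x).mkQ.compLeft (Fin p))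
  have h2 : LinearMap.range ((K ∙ x).mkQ.compLeft (Fin p)) = ⊤ := by
    rw [LinearMap.range_eq_top]
    exact (K ∙ x).mkQ_surjective.comp_left
  have h3 := Submodule.finrank_quotient_add_finrank (K ∙ x)
  rw [finrank_span_singleton hx] at h3
  rw [h2, finrank_top, Module.finrank_pi_fintype, Module.finrank_pi_fintype] at h1
  simp only [Finset.sum_const, Finset.card_univ, Fintype.card_fin, smul_eq_mul] at h1
  refine (Submodule.finrank_mono inf_le_right).trans ?_
  have : p * Module.finrank K F = p * Module.finrank K (F ⧸ K ∙ x) + p := by rw [← h3]; ring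
  omega

/-- An affine space of families contains a linearly independent one if its image modulo a nonzero
vector of the `headColumn` contains one after removal of column `0`. -/
theorem exists_linearIndependent_add_of_quotient {K F : Type*} [Field K] [AddCommGroup F]
    [Module K F] {p : ℕ} {H : Submodule K (Fin (p + 1) → F)}
    {A : Fin (p + 1) → F} {x : F} (hx : x ∈ H.headColumn) (hx0 : x ≠ 0)
    (h : ∃ B ∈ (H.map (LinearMap.funLeft K F Fin.succ)).map ((K ∙ x).mkQ.compLeft (Fin p)),
      LinearIndependent K (((K ∙ x).mkQ ∘ fun i : Fin p => A i.succ) + B)) :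
    ∃ M ∈ H, LinearIndependent K (A + M) := by
  obtain ⟨_, ⟨_, ⟨M, hM, rfl⟩, rfl⟩, hB⟩ := h
  have hAM : ((K ∙ x).mkQ ∘ fun i : Fin p => A i.succ) +
      (K ∙ x).mkQ.compLeft (Fin p) (LinearMap.funLeft K F Fin.succ M) =
      (K ∙ x).mkQ ∘ fun i : Fin p => (A + M) i.succ := by
    ext i
    exact ((K ∙ x).mkQ.map_add _ _).symm
  rw [hAM] at hB
  have := LinearIndependent.of_mkQ_span_singleton hx0 hB
  exact exists_linearIndependent_add_of_tail hM this.1 hx this.2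

theorem exists_linearIndependent_add_of_lt_finrank_headColumn {K F : Type*} [Field K]
    [AddCommGroup F] [Module K F] [FiniteDimensional K F] {p : ℕ}
    {H : Submodule K (Fin (p + 1) → F)} {A : Fin (p + 1) → F}
    (hp : p < Module.finrank K H.headColumn)
    (h : ∃ B ∈ H.map (LinearMap.funLeft K F Fin.succ),
      LinearIndependent K ((fun i : Fin p => A i.succ) + B)) :
    ∃ M ∈ H, LinearIndependent K (A + M) := by
  obtain ⟨_, ⟨M, hM, rfl⟩, hB⟩ := h
  have hB' : LinearIndependent K fun i : Fin p => (A + M) i.succ := hB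
  obtain ⟨x, hx, hxM⟩ : ∃ x ∈ H.headColumn,
      x ∉ Submodule.span K (Set.range fun i : Fin p => (A + M) i.succ) := by
    by_contra! hcon
    have := Submodule.finrank_mono (R := K) (M := F) (s := H.headColumn) hcon
    rw [finrank_span_eq_card hB', Fintype.card_fin] at this
    omega
  exact exists_linearIndependent_add_of_tail hM hB' hx hxM

/-- An affine space of `n × p` matrices with `p ≤ n` and codimension less than `n` contains a
matrix of rank `p`. -/
theorem exists_linearIndependent_add_of_codim_lt {K : Type*} [Field K] (p : ℕ) :
    ∀ {F : Type*} [AddCommGroup F] [Module K F] [FiniteDimensional K F]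
    (H : Submodule K (Fin p → F)) (A : Fin p → F), p ≤ Module.finrank K F →
    p * Module.finrank K F < Module.finrank K H + Module.finrank K F →
    ∃ M ∈ H, LinearIndependent K (A + M) := by
  induction p with
  | zero => exact fun H A _ _ => ⟨0, H.zero_mem, linearIndependent_empty_type⟩
  | succ p ih =>
    intro F _ _ _ H A hp hH
    have h1 := H.finrank_tail_add_finrank_headColumn
    have h2 := Submodule.finrank_le H.headColumn
    rw [add_mul, one_mul] at hH
    by_cases h : p < Module.finrank K H.headColumn
    · exact exists_linearIndependent_add_of_lt_finrank_headColumn h (ih _ _ (by omega) (by omega))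
    -- Since `codim H < dim F`, the head column space is nonzero. The tail has codimension less than
    -- `dim H.headColumn ≤ p ≤ dim F - 1`, so the induction hypothesis applies modulo `x`.
    · have h3 : Module.finrank K (H.map (LinearMap.funLeft K F (Fin.succ : Fin p → _))) ≤
          p * Module.finrank K F := by
        refine (Submodule.finrank_le _).trans ?_
        simp [Module.finrank_pi_fintype]
      obtain ⟨x, hx, hx0⟩ := H.headColumn.exists_mem_ne_zero_of_ne_bot (by
        rw [← Submodule.finrank_eq_zero (R := K).ne]; omega)
      have h4 := (H.map (LinearMap.funLeft K F Fin.succ)).finrank_le_finrank_map_mkQ_add x hx0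
      have h5 := Submodule.finrank_quotient_add_finrank (K ∙ x)
      rw [finrank_span_singleton hx0] at h5
      have h6 : p * Module.finrank K F = p * Module.finrank K (F ⧸ K ∙ x) + p := by
        rw [← h5]; ring
      exact exists_linearIndependent_add_of_quotient hx hx0 (ih _ _ (by omega) (by omega))

/-- An affine space of `n × p` matrices with `p < n` that has codimension at most `n` and does not
contain `0` contains a matrix of rank `p`. -/
theorem exists_linearIndependent_add_of_codim_le {K : Type*} [Field K] (p : ℕ) :
    ∀ {F : Type*} [AddCommGroup F] [Module K F] [FiniteDimensional K F]
    (H : Submodule K (Fin p → F)) (A : Fin p → F), p < Module.finrank K F → A ∉ H →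
    p * Module.finrank K F ≤ Module.finrank K H + Module.finrank K F →
    ∃ M ∈ H, LinearIndependent K (A + M) := by
  induction p with
  | zero => exact fun H A _ _ _ => ⟨0, H.zero_mem, linearIndependent_empty_type⟩
  | succ p ih =>
    intro F _ _ _ H A hp hA hH
    have h1 := H.finrank_tail_add_finrank_headColumn
    have h2 := Submodule.finrank_le H.headColumn
    rw [add_mul, one_mul] at hH
    by_cases h : p < Module.finrank K H.headColumn
    · refine exists_linearIndependent_add_of_lt_finrank_headColumn h ?_
      -- If column `0` is free, the tail of `A` still avoids the tail of `H`, and induction applies.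
      -- Otherwise the tail has codimension less than `dim F`.
      by_cases h' : Module.finrank K H.headColumn = Module.finrank K F
      · refine ih _ _ (by omega) ?_ (by omega)
        rintro ⟨M, hM, hMA⟩
        apply hA
        have h3 : A - M = Pi.single 0 ((A - M) 0) := by
          ext i
          refine Fin.cases (by simp) (fun i => ?_) i
          have := congr_fun hMA i
          simpa [LinearMap.funLeft_apply, sub_eq_zero] using this.symm
        have h4 : (A - M) 0 ∈ H.headColumn := by
          rw [Submodule.eq_top_of_finrank_eq h']; trivial
        have h5 : A - M ∈ H := by rw [h3]; exact h4
        simpa using H.add_mem h5 hM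
      · exact exists_linearIndependent_add_of_codim_lt p _ _ (by omega) (by omega)
    · by_cases h0 : Module.finrank K H.headColumn = 0
      -- Here `H` is a graph: on `A + H`, column `0` is an affine function `v` of the family `B` of
      -- the other columns. If the conclusion fails, `v B` lies in the span of `B` for every
      -- independent `B`, while `v 0 ≠ 0` because `A ∉ H`.
      · have htop : H.map (LinearMap.funLeft K F (Fin.succ : Fin p → _)) = ⊤ := by
          apply Submodule.eq_top_of_finrank_eq
          refine le_antisymm (Submodule.finrank_le _) ?_
          simp only [Module.finrank_pi_fintype, Finset.sum_const, Finset.card_univ,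
            Fintype.card_fin, smul_eq_mul]
          omega
        have hsec : ∀ B : Fin p → F, ∃ M ∈ H, ∀ i, (A + M) i.succ = B i := by
          intro B
          have : B - (fun i => A i.succ) ∈ H.map (LinearMap.funLeft K F Fin.succ) := by
            rw [htop]; trivial
          obtain ⟨M, hM, hMB⟩ := this
          refine ⟨M, hM, fun i => ?_⟩
          have := congr_fun hMB i
          simp only [LinearMap.funLeft_apply, Pi.sub_apply] at this
          simp [this]
        choose N hN hNB using hsec
        by_contra! hcon
        have hspan : ∀ B : Fin p → F, LinearIndependent K B →
            (A + N B) 0 ∈ Submodule.span K (Set.range B) := by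
          intro B hB
          by_contra hB0
          apply hcon _ (hN B)
          rw [← Fin.cons_self_tail (A + N B), linearIndependent_finCons]
          have : Fin.tail (A + N B) = B := funext (hNB B)
          rw [this]
          exact ⟨hB, hB0⟩
        have huniq : ∀ M ∈ H, (∀ i : Fin p, M i.succ = 0) → M 0 = 0 := by
          intro M hM hM0
          have h3 : Pi.single 0 (M 0) = M := by
            ext i
            refine Fin.cases (by simp) (fun i => ?_) i
            simp [hM0]
          have h4 : M 0 ∈ H.headColumn := by
            change Pi.single 0 (M 0) ∈ H
            rwa [h3]
          rw [Submodule.finrank_eq_zero.1 h0] at h4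
          simpa using h4
        have hv : (A + N 0) 0 ≠ 0 := by
          intro h3
          apply hA
          have : A = - N 0 := by
            rw [← add_eq_zero_iff_eq_neg]
            ext i
            refine Fin.cases h3 (fun i => ?_) i
            rw [hNB]; rfl
          rw [this]
          exact H.neg_mem (hN 0)
        -- As `p + 1 < dim F`, there are `p + 1` independent vectors whose span avoids `v 0`. The
        -- families `B₁`, `B₂` and `B₁ + B₂` are independent in that span, and affinity gives `v 0 =
        -- v B₁ + v B₂ - v (B₁ + B₂)`, which puts `v 0` in it.
        obtain ⟨u, hu, huv⟩ := exists_linearIndependent_notMem_span (K := K) hv hp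
        let B₁ : Fin p → F := fun i => u i.castSucc
        let B₂ : Fin p → F := fun i => u i.succ
        have hB₁ : LinearIndependent K B₁ := hu.comp _ (Fin.castSucc_injective p)
        have hB₂ : LinearIndependent K B₂ := hu.comp _ (Fin.succ_injective p)
        have hB₃ : LinearIndependent K (B₁ + B₂) := hu.castSucc_add_succ
        have hle₁ : Submodule.span K (Set.range B₁) ≤ Submodule.span K (Set.range u) :=
          Submodule.span_mono (Set.range_comp_subset_range Fin.castSucc u)
        have hle₂ : Submodule.span K (Set.range B₂) ≤ Submodule.span K (Set.range u) :=
          Submodule.span_mono (Set.range_comp_subset_range Fin.succ u)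
        have hle₃ : Submodule.span K (Set.range (B₁ + B₂)) ≤ Submodule.span K (Set.range u) := by
          rw [Submodule.span_le]
          rintro _ ⟨i, rfl⟩
          exact Submodule.add_mem _ (Submodule.subset_span ⟨_, rfl⟩) (Submodule.subset_span ⟨_, rfl⟩)
        have hzero := huniq (N 0 - N B₁ - N B₂ + N (B₁ + B₂))
          (H.add_mem (H.sub_mem (H.sub_mem (hN _) (hN _)) (hN _)) (hN _)) (fun i => by
            have e0 := hNB 0 i
            have e1 := hNB B₁ i
            have e2 := hNB B₂ i
            have e3 := hNB (B₁ + B₂) i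
            simp only [Pi.add_apply, Pi.sub_apply, Pi.zero_apply] at e0 e1 e2 e3 ⊢
            linear_combination (norm := module) e0 - e1 - e2 + e3)
        apply huv
        have : (A + N 0) 0 = (A + N B₁) 0 + (A + N B₂) 0 - (A + N (B₁ + B₂)) 0 := by
          simp only [Pi.add_apply, Pi.sub_apply] at hzero ⊢
          linear_combination (norm := module) hzero
        rw [this]
        exact Submodule.sub_mem _ (Submodule.add_mem _ (hle₁ (hspan _ hB₁)) (hle₂ (hspan _ hB₂)))
          (hle₃ (hspan _ hB₃))
      · obtain ⟨x, hx, hx0⟩ := H.headColumn.exists_mem_ne_zero_of_ne_bot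
          fun h => h0 (Submodule.finrank_eq_zero.2 h)
        have h4 := (H.map (LinearMap.funLeft K F Fin.succ)).finrank_le_finrank_map_mkQ_add x hx0
        have h5 := Submodule.finrank_quotient_add_finrank (K ∙ x)
        rw [finrank_span_singleton hx0] at h5
        have h6 : p * Module.finrank K F = p * Module.finrank K (F ⧸ K ∙ x) + p := by
          rw [← h5]; ring
        exact exists_linearIndependent_add_of_quotient hx hx0
          (exists_linearIndependent_add_of_codim_lt p _ _ (by omega) (by omega))

/-! ### Operator spaces: raising the rank, and bounding the minimal rank -/

theorem Submodule.finrank_quotient_comap_le {K E F : Type*} [Field K] [AddCommGroup E]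
    [Module K E] [AddCommGroup F] [Module K F] [FiniteDimensional K F] (f : E →ₗ[K] F)
    (W : Submodule K F) :
    Module.finrank K (E ⧸ W.comap f) ≤ Module.finrank K (F ⧸ W) := by
  refine LinearMap.finrank_le_finrank_of_injective (f := (W.comap f).mapQ W f le_rfl) ?_
  rw [← LinearMap.ker_eq_bot, Submodule.ker_mapQ, Submodule.mkQ_map_self]

theorem Submodule.finrank_quotient_inf_ker_le {K E : Type*} [Field K] [AddCommGroup E]
    [Module K E] [FiniteDimensional K E] (V : Submodule K E) (f : Module.Dual K E) :
    Module.finrank K (E ⧸ (V ⊓ LinearMap.ker f)) ≤ Module.finrank K (E ⧸ V) + 1 := by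
  have h1 := V.finrank_map_add_finrank_inf_ker f
  have h2 := Submodule.finrank_le (V.map f)
  have h3 := Submodule.finrank_quotient_add_finrank V
  have h4 := Submodule.finrank_quotient_add_finrank (V ⊓ LinearMap.ker f)
  rw [Module.finrank_self] at h2
  omega

theorem exists_submodule_le_finrank_eq {K E : Type*} [Field K] [AddCommGroup E]
    [Module K E] [FiniteDimensional K E] (V : Submodule K E) {m : ℕ}
    (hm : m ≤ Module.finrank K V) : ∃ W ≤ V, Module.finrank K W = m := by
  obtain ⟨w, hw⟩ := exists_linearIndependent_of_le_finrank (R := K) (M := V) (n := m) hm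
  refine ⟨(Submodule.span K (Set.range w)).map V.subtype, Submodule.map_subtype_le _ _, ?_⟩
  rw [Submodule.finrank_map_subtype_eq, finrank_span_eq_card hw, Fintype.card_fin]

/-- In an operator space of codimension less than `dim F`, an operator of rank `s` is a combination
of operators of rank `s + 1`. -/
theorem mem_span_finrank_range_succ {K E F : Type*} [Field K] [AddCommGroup E] [Module K E]
    [FiniteDimensional K E] [AddCommGroup F] [Module K F] [FiniteDimensional K F]
    {V : Submodule K (E →ₗ[K] F)}
    (hV : Module.finrank K ((E →ₗ[K] F) ⧸ V) < Module.finrank K F) {N : E →ₗ[K] F} (hN : N ∈ V)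
    (hE : Module.finrank K (LinearMap.range N) < Module.finrank K E)
    (hF : Module.finrank K (LinearMap.range N) + 1 < Module.finrank K F) :
    N ∈ Submodule.span K {M : E →ₗ[K] F | M ∈ V ∧
      Module.finrank K (LinearMap.range M) = Module.finrank K (LinearMap.range N) + 1} := by
  set s := Module.finrank K (LinearMap.range N) with hs
  have hrn := LinearMap.finrank_range_add_finrank_ker N
  -- Operators that vanish on `L` correspond to families of `s + 1` vectors of `F`, and `N` is among
  -- them; the independent families are exactly those of rank `s + 1`.
  obtain ⟨L, hLN, hL⟩ := exists_submodule_le_finrank_eq (LinearMap.ker N)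
    (m := Module.finrank K E - (s + 1)) (by omega)
  have hLq := Submodule.finrank_quotient_add_finrank L
  have b : Module.Basis (Fin (s + 1)) K (E ⧸ L) := Module.finBasisOfFinrankEq K _ (by omega)
  let Φ : (Fin (s + 1) → F) →ₗ[K] (E →ₗ[K] F) :=
    LinearMap.lcomp K F L.mkQ ∘ₗ (b.constr K (M' := F)).toLinearMap
  have hΦ : ∀ X, LinearIndependent K X →
      Module.finrank K (LinearMap.range (Φ X)) = s + 1 := by
    intro X hX
    have : Φ X = b.constr K X ∘ₗ L.mkQ := rfl
    rw [this, LinearMap.range_comp_of_range_eq_top _ L.range_mkQ, b.constr_range,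
      finrank_span_eq_card hX, Fintype.card_fin]
  let X₀ := (b.constr K (M' := F)).symm (L.liftQ N hLN)
  have hX₀ : Φ X₀ = N := by
    simp only [Φ, X₀, LinearMap.comp_apply, LinearEquiv.coe_coe, LinearEquiv.apply_symm_apply]
    exact L.liftQ_mkQ N hLN
  by_contra hcon
  obtain ⟨f, hfN, hf⟩ := Submodule.exists_le_ker_of_notMem hcon
  -- Intersecting with `ker f` may raise the codimension to `dim F`, hence the need for the
  -- full-rank lemma with non-strict bound; its hypothesis `A ∉ H` holds because `f N ≠ 0`.
  have h1 := (V ⊓ LinearMap.ker f).finrank_quotient_comap_le Φ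
  have h2 := V.finrank_quotient_inf_ker_le f
  have h3 := Submodule.finrank_quotient_add_finrank ((V ⊓ LinearMap.ker f).comap Φ)
  have h4 : Module.finrank K (Fin (s + 1) → F) = (s + 1) * Module.finrank K F := by
    simp [Module.finrank_pi_fintype]
  obtain ⟨M, hM, hLI⟩ := exists_linearIndependent_add_of_codim_le (s + 1)
    ((V ⊓ LinearMap.ker f).comap Φ) X₀ hF (fun h => hfN (hX₀ ▸ h.2)) (by omega)
  have h5 : Φ (X₀ + M) ∈ LinearMap.ker f := by
    refine hf (Submodule.subset_span ⟨?_, hΦ _ hLI⟩)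
    rw [map_add, hX₀]
    exact V.add_mem hN hM.1
  rw [LinearMap.mem_ker, map_add, map_add, hX₀, LinearMap.mem_ker.1 hM.2, add_zero] at h5
  exact hfN h5

theorem mem_span_finrank_range_eq {K E F : Type*} [Field K] [AddCommGroup E] [Module K E]
    [FiniteDimensional K E] [AddCommGroup F] [Module K F] [FiniteDimensional K F]
    {V : Submodule K (E →ₗ[K] F)}
    (hV : Module.finrank K ((E →ₗ[K] F) ⧸ V) < Module.finrank K F) {r : ℕ}
    (hE : r < Module.finrank K E) (hF : r < Module.finrank K F) (k : ℕ) :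
    ∀ N ∈ V, Module.finrank K (LinearMap.range N) + k = r →
      N ∈ Submodule.span K {M : E →ₗ[K] F | M ∈ V ∧
        Module.finrank K (LinearMap.range M) = r} := by
  induction k with
  | zero => exact fun N hN hr => Submodule.subset_span ⟨hN, hr⟩
  | succ k ih =>
    intro N hN hr
    refine Submodule.span_le.2 ?_ (mem_span_finrank_range_succ hV hN (by omega) (by omega))
    rintro M ⟨hM, hMr⟩
    exact ih M hM (by omega)

/-- If `A` has minimal rank `t` in an affine space of operators, then that space has codimension at
least `t * (t + 1) / 2`. -/
theorem choose_two_le_finrank_quotient_of_forall_finrank_range_le {K E F : Type*} [Field K]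
    [AddCommGroup E] [Module K E] [FiniteDimensional K E] [AddCommGroup F] [Module K F]
    [FiniteDimensional K F] {H : Submodule K (E →ₗ[K] F)} {A : E →ₗ[K] F}
    (h : ∀ M ∈ H, Module.finrank K (LinearMap.range A) ≤
      Module.finrank K (LinearMap.range (A - M))) :
    (Module.finrank K (LinearMap.range A) + 1).choose 2 ≤
      Module.finrank K ((E →ₗ[K] F) ⧸ H) := by
  set t := Module.finrank K (LinearMap.range A) with ht
  let Ψ : Module.End K (LinearMap.range A) →ₗ[K] (E →ₗ[K] F) :=
    LinearMap.lcomp K F A.rangeRestrict ∘ₗ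
      LinearMap.compRight K (M := LinearMap.range A) (LinearMap.range A).subtype
  -- The rank of `A - Ψ X` is that of `1 - X`, so minimality of `t` makes `1 - X` injective.
  have hfix : (H.comap Ψ).FixedPointFree := by
    intro X hX x hx
    by_contra hx0
    have h1 := h _ hX
    have h2 : A - Ψ X = (LinearMap.range A).subtype ∘ₗ (1 - X) ∘ₗ A.rangeRestrict := by
      ext e
      simp [Ψ]
    rw [h2, LinearMap.range_comp, LinearMap.range_comp_of_range_eq_top _ A.range_rangeRestrict,
      Submodule.finrank_map_subtype_eq] at h1
    have h3 := LinearMap.finrank_range_add_finrank_ker (1 - X)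
    have h4 : LinearMap.ker (1 - X) = ⊥ := by
      rw [← Submodule.finrank_eq_zero (R := K)]
      omega
    have h5 : x ∈ LinearMap.ker (1 - X) := by simp [hx]
    rw [h4] at h5
    exact hx0 (by simpa using h5)
  have h1 := hfix.finrank_le t rfl
  have h2 := H.finrank_quotient_comap_le Ψ
  have h3 := Submodule.finrank_quotient_add_finrank (H.comap Ψ)
  have h4 : Module.finrank K (Module.End K (LinearMap.range A)) = t * t :=
    Module.finrank_linearMap K K _ _
  have h5 : (t + 1).choose 2 = t + t.choose 2 := by
    rw [Nat.choose_succ_succ' t 1]; simp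
  -- Thus `t * t - t.choose 2 = t + t.choose 2 = (t + 1).choose 2`, the required codimension.
  have h6 : t * t = t + 2 * t.choose 2 := by
    rw [Nat.choose_two_right, Nat.mul_div_cancel' (Nat.even_mul_pred_self t).two_dvd]
    cases t with
    | zero => rfl
    | succ t => rw [Nat.add_sub_cancel]; ring
  rw [h4] at h3
  omega

/-! ### The spanning theorem for operators -/

theorem span_finrank_range_eq {K E F : Type*} [Field K] [AddCommGroup E] [Module K E]
    [FiniteDimensional K E] [AddCommGroup F] [Module K F] [FiniteDimensional K F]
    {V : Submodule K (E →ₗ[K] F)}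
    (hV : Module.finrank K ((E →ₗ[K] F) ⧸ V) < Module.finrank K F) {r : ℕ}
    (hVr : Module.finrank K ((E →ₗ[K] F) ⧸ V) + 1 < (r + 2).choose 2)
    (hE : r < Module.finrank K E) (hF : r < Module.finrank K F) :
    Submodule.span K {M : E →ₗ[K] F | M ∈ V ∧
      Module.finrank K (LinearMap.range M) = r} = V := by
  refine le_antisymm (Submodule.span_le.2 fun M hM => hM.1) fun A₀ hA₀ => ?_
  by_contra hcon
  obtain ⟨f, hfA, hf⟩ := Submodule.exists_le_ker_of_notMem hcon
  classical
  have hex : ∃ t, ∃ M ∈ V ⊓ LinearMap.ker f,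
      Module.finrank K (LinearMap.range (A₀ - M)) = t := ⟨_, 0, Submodule.zero_mem _, rfl⟩
  obtain ⟨M, hM, hMt⟩ := Nat.find_spec hex
  have h1 := choose_two_le_finrank_quotient_of_forall_finrank_range_le
    (H := V ⊓ LinearMap.ker f) (A := A₀ - M) (by
      intro M' hM'
      rw [hMt]
      exact Nat.find_min' hex ⟨M + M', Submodule.add_mem _ hM hM', by rw [sub_sub]⟩)
  have h2 := V.finrank_quotient_inf_ker_le f
  -- A minimal rank of at least `r + 1` would force `codim (V ⊓ ker f) ≥ (r + 2).choose 2`, one more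
  -- than `hVr` permits.
  have h3 : Module.finrank K (LinearMap.range (A₀ - M)) ≤ r := by
    by_contra! h
    have : (r + 2).choose 2 ≤ (Module.finrank K (LinearMap.range (A₀ - M)) + 1).choose 2 :=
      Nat.choose_le_choose 2 (by omega)
    omega
  have h4 : f (A₀ - M) = 0 := hf (mem_span_finrank_range_eq hV hE hF
    (r - Module.finrank K (LinearMap.range (A₀ - M))) (A₀ - M) (V.sub_mem hA₀ hM.1) (by omega))
  rw [map_sub, LinearMap.mem_ker.1 hM.2, sub_zero] at h4
  exact hfA h4

/-! ### Tightness of the bound -/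

/-- Take the matrices whose leading block of size `r + 1` is upper triangular with constant
diagonal. A nonzero diagonal makes the block invertible, so the rank `r` members all have zero
corner entry, unlike the member `D`. -/
theorem exists_submodule_span_rank_ne {K : Type*} [Field K] {n p r : ℕ} (hn : r + 1 ≤ n)
    (hp : r + 1 ≤ p) : ∃ V : Submodule K (Matrix (Fin n) (Fin p) K),
      Module.finrank K (Matrix (Fin n) (Fin p) K ⧸ V) = (r + 2).choose 2 - 1 ∧
      Submodule.span K {M : Matrix (Fin n) (Fin p) K | M ∈ V ∧ M.rank = r} ≠ V := by
  classical
  let S : Finset (Fin (r + 1) × Fin (r + 1)) := Finset.univ.filter fun x => x.2 ≤ x.1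
  have hS : S.card = (r + 2).choose 2 := by
    have h1 : S.card = ∑ i : Fin (r + 1), ((i : ℕ) + 1) := by
      rw [Finset.card_filter, ← Finset.univ_product_univ, Finset.sum_product]
      refine Finset.sum_congr rfl fun i _ => ?_
      rw [← Finset.card_filter, Finset.filter_ge_eq_Iic]
      simp
    rw [h1, Fin.sum_univ_eq_sum_range (fun i => i + 1) (r + 1), Finset.sum_add_distrib,
      Finset.sum_range_id]
    rw [Nat.choose_two_right]
    simp
    have h2 : (r + 2) * (r + 1) = (r + 1) * r + (r + 1) * 2 := by ring
    omega
  -- One equation for each entry on or below the diagonal, except the corner, with which the other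
  -- diagonal entries are compared.
  let T := S.erase (0, 0)
  have hT : Fintype.card T = (r + 2).choose 2 - 1 := by
    rw [Fintype.card_coe, Finset.card_erase_of_mem (by simp [S]), hS]
  let L : Matrix (Fin n) (Fin p) K →ₗ[K] (T → K) :=
    { toFun := fun M x => M (Fin.castLE hn x.1.1) (Fin.castLE hp x.1.2) -
        if x.1.1 = x.1.2 then M (Fin.castLE hn 0) (Fin.castLE hp 0) else 0
      map_add' := by
        intro M N; ext x; simp only [Matrix.add_apply, Pi.add_apply]; split_ifs <;> ring
      map_smul' := by
        intro c N; ext x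
        simp only [Matrix.smul_apply, Pi.smul_apply, smul_eq_mul, RingHom.id_apply]
        split_ifs <;> ring }
  have hL : Function.Surjective L := by
    intro g
    refine ⟨Matrix.of fun i j => if h : ∃ x : T, Fin.castLE hn x.1.1 = i ∧ Fin.castLE hp x.1.2 = j
      then g h.choose else 0, ?_⟩
    ext x
    have hx : ∃ x' : T, Fin.castLE hn x'.1.1 = Fin.castLE hn x.1.1 ∧
      Fin.castLE hp x'.1.2 = Fin.castLE hp x.1.2 := ⟨x, rfl, rfl⟩
    have h0 : ¬ ∃ x' : T, Fin.castLE hn x'.1.1 = Fin.castLE hn 0 ∧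
        Fin.castLE hp x'.1.2 = Fin.castLE hp 0 := by
      rintro ⟨⟨x', hx'⟩, h1, h2⟩
      exact (Finset.mem_erase.1 hx').1
        (Prod.ext (Fin.castLE_injective hn h1) (Fin.castLE_injective hp h2))
    have hc : hx.choose = x := Subtype.ext
      (Prod.ext (Fin.castLE_injective hn hx.choose_spec.1)
        (Fin.castLE_injective hp hx.choose_spec.2))
    simp only [L, LinearMap.coe_mk, AddHom.coe_mk, Matrix.of_apply, dif_pos hx, dif_neg h0, hc]
    simp
  refine ⟨LinearMap.ker L, ?_, fun hspan => ?_⟩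
  · rw [(L.quotKerEquivOfSurjective hL).finrank_eq, Module.finrank_pi, hT]
  · let D : Matrix (Fin n) (Fin p) K :=
      Matrix.of fun i j => if (i : ℕ) = j then 1 else 0
    have hD : D ∈ LinearMap.ker L := by
      rw [LinearMap.mem_ker]
      ext x
      simp [L, D, Fin.ext_iff]
    have hle : LinearMap.ker L ≤ LinearMap.ker
        (Matrix.entryLinearMap K K (Fin.castLE hn 0) (Fin.castLE hp 0)) := by
      rw [← hspan, Submodule.span_le]
      rintro M ⟨hM, hr⟩
      by_contra h0
      replace h0 : M (Fin.castLE hn 0) (Fin.castLE hp 0) ≠ 0 := h0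
      let B := M.submatrix (Fin.castLE hn) (Fin.castLE hp)
      have hBentry : ∀ i j, j ≤ i →
          B i j = if i = j then M (Fin.castLE hn 0) (Fin.castLE hp 0) else 0 := by
        intro i j hij
        by_cases h : (i, j) = (0, 0)
        · obtain ⟨rfl, rfl⟩ := Prod.mk.inj h
          simp [B]
        · have := congr_fun (LinearMap.mem_ker.1 hM) ⟨(i, j), Finset.mem_erase.2 ⟨h, by simp [S, hij]⟩⟩
          exact sub_eq_zero.1 this
      have htri : B.BlockTriangular id := by
        intro i j hij
        have hij' : j < i := hij
        rw [hBentry i j hij'.le, if_neg hij'.ne']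
      have hdet : B.det ≠ 0 := by
        rw [Matrix.det_of_isUpperTriangular htri]
        exact Finset.prod_ne_zero_iff.2 fun i _ => by rw [hBentry i i le_rfl, if_pos rfl]; exact h0
      have hB : B.rank = r + 1 := by
        rw [Matrix.rank_of_isUnit B ((Matrix.isUnit_iff_isUnit_det B).2 hdet.isUnit)]
        simp
      have := Matrix.rank_submatrix_le M (Fin.castLE hn) (Fin.castLE hp)
      change B.rank ≤ _ at this
      omega
    have := hle hD
    simp [D] at this

/-! ### The theorem for matrices -/

theorem theorem3 {K : Type*} [Field K] (n p r : ℕ) (hnp : p ≤ n) (hr1 : 1 ≤ r) (hrp : r ≤ p - 1) :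
    (∀ V : Submodule K (Matrix (Fin n) (Fin p) K),
      Module.finrank K (Matrix (Fin n) (Fin p) K ⧸ V) < n →
      Module.finrank K (Matrix (Fin n) (Fin p) K ⧸ V) ≤ (r + 2).choose 2 - 2 →
      Submodule.span K {M : Matrix (Fin n) (Fin p) K | M ∈ V ∧ M.rank = r} = V) ∧
    (∃ V : Submodule K (Matrix (Fin n) (Fin p) K),
      Module.finrank K (Matrix (Fin n) (Fin p) K ⧸ V) = (r + 2).choose 2 - 1 ∧
      Submodule.span K {M : Matrix (Fin n) (Fin p) K | M ∈ V ∧ M.rank = r} ≠ V) := by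
  refine ⟨fun V hV hVr => ?_,
    exists_submodule_span_rank_ne (by omega) (by omega)⟩
  let e : Matrix (Fin n) (Fin p) K ≃ₗ[K] ((Fin p → K) →ₗ[K] (Fin n → K)) := Matrix.toLin'
  have hq : Module.finrank K (((Fin p → K) →ₗ[K] (Fin n → K)) ⧸ V.map e.toLinearMap) =
      Module.finrank K (Matrix (Fin n) (Fin p) K ⧸ V) :=
    (Submodule.Quotient.equiv V _ e rfl).finrank_eq.symm
  -- Ensures that the natural subtraction in `(r + 2).choose 2 - 2` is not truncated.
  have hc : 3 ≤ (r + 2).choose 2 := Nat.choose_le_choose (a := 3) 2 (by omega)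
  have h := span_finrank_range_eq (V := V.map e.toLinearMap) (r := r)
    (by rw [hq, Module.finrank_fin_fun]; exact hV) (by omega)
    (by rw [Module.finrank_fin_fun]; omega) (by rw [Module.finrank_fin_fun]; omega)
  apply Submodule.map_injective_of_injective e.injective
  refine Eq.trans ?_ h
  rw [Submodule.map_span]
  congr 1
  ext f
  constructor
  · rintro ⟨M, ⟨hM, hr⟩, rfl⟩
    exact ⟨Submodule.mem_map_of_mem hM, hr⟩
  · rintro ⟨⟨M, hM, rfl⟩, hr⟩
    exact ⟨M, ⟨hM, hr⟩, rfl⟩
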